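/- Let $\mathbb D\subset\mathbb C$ be the open unit disc and let $\Gamma<\mathrm{Aut}(\mathbb D)=PSU(1,1)$ be a Fuchsian group acting freely on $\mathbb D$ with compact quotient, so that $\Sigma=\mathbb D/\Gamma$ is a compact Riemann surface of genus at least $2$. For $N\ge 1$ identify $H^0(\Sigma,K_\Sigma^{\otimes N})$ with the $\Gamma$-invariant holomorphic $N$-differentials $\psi=\psi(\tau)\,d\tau^{\otimes N}$ on $\mathbb D$ and put, for $z,w\in\mathbb D$, $$I(\psi)(z,w)=\frac1{B(N,N)}\int_{\tau\in\overline{zw}}\frac{\psi(\tau)\,d\tau^{\otimes N}}{[w,\tau,z]^{\otimes(N-1)}},\qquad [w,\tau,z]=\frac{(w-z)\,d\tau}{(w-\tau)(\tau-z)},$$ where $\overline{zw}$ is the geodesic segment of the Poincaré metric, oriented from $z$ to $w$, $B$ is the beta function, and $I(\psi)(z,z)=0$. Let $N\ge 2$. The Poincaré series $P_N=\sum_{\gamma\in\Gamma}\gamma^*d\tau^{\otimes N}=\sum_{\gamma\in\Gamma}\gamma'(\tau)^N\,d\tau^{\otimes N}$ converges locally uniformly on $\mathbb D$ and is a $\Gamma$-invariant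 holomorphic $N$-differential, that is, $P_N\in H^0(\Sigma,K_\Sigma^{\otimes N})$. For all $z,w\in\mathbb D$ the series below converge absolutely and $$I(P_N)(z,w)=\sum_{\gamma\in\Gamma}(\gamma(w)-\gamma(z))^N=(-1)^N\sum_{\gamma\in\Gamma}(\gamma(z)-\gamma(w))^N .$$ Moreover, $I(P_N)$ is a holomorphic function on $\mathbb D\times\mathbb D$, invariant under the diagonal action of $\Gamma$. -/

import Mathlib

open scoped Complex.UnitDisc ComplexConjugate

noncomputable section

namespace DiscQuotient

/-- The extension by zero to `ℂ` of a function on the unit disc. -/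
def extend (f : 𝔻 → ℂ) : ℂ → ℂ := fun z => if h : ‖z‖ < 1 then f (.mk z h) else 0

/-- `f` is holomorphic on the unit disc. -/
def Holomorphic (f : 𝔻 → ℂ) : Prop := DifferentiableOn ℂ (extend f) (Metric.ball 0 1)

/-- `F` is holomorphic on the bidisc `𝔻 × 𝔻` (as a function of two complex variables). -/
def Holomorphic₂ (F : 𝔻 → 𝔻 → ℂ) : Prop :=
  DifferentiableOn ℂ (fun p : ℂ × ℂ => extend (fun z => extend (F z) p.2) p.1)
    (Metric.ball 0 1 ×ˢ Metric.ball 0 1)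

/-- The complex derivative `γ'` of a self-map `γ` of the unit disc. -/
def derivative (γ : 𝔻 → 𝔻) (τ : 𝔻) : ℂ := deriv (extend fun z => (γ z : ℂ)) τ

/-- The permutation `γ` of the disc is the transformation
`z ↦ (α z + β) / (conj β z + conj α)` for some `α`, `β` with `|α|² - |β|² = 1`. -/
def IsMobius (γ : Equiv.Perm 𝔻) : Prop :=
  ∃ α β : ℂ, ‖α‖ ^ 2 - ‖β‖ ^ 2 = 1 ∧
    ∀ z : 𝔻, (γ z : ℂ) = (α * z + β) / (conj β * z + conj α)

lemma normSq_identity (α β : ℂ) (h : ‖α‖ ^ 2 - ‖β‖ ^ 2 = 1) :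
    α * conj α - β * conj β = 1 := by
  rw [Complex.mul_conj', Complex.mul_conj']
  exact_mod_cast h

lemma den_ne_zero (α β : ℂ) (h : ‖α‖ ^ 2 - ‖β‖ ^ 2 = 1) (z : 𝔻) :
    conj β * (z : ℂ) + conj α ≠ 0 := by
  intro h0
  have h1 : conj α = -(conj β * (z : ℂ)) := by linear_combination h0
  have h2 : ‖α‖ = ‖β‖ * ‖(z : ℂ)‖ := by
    simpa using congrArg norm h1
  have hz := z.norm_lt_one
  have : ‖α‖ ≤ ‖β‖ := by
    rw [h2]; exact mul_le_of_le_one_right (norm_nonneg _) hz.le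
  nlinarith [norm_nonneg α, norm_nonneg β]

/-- `Aut(𝔻) = PSU(1,1)`, as a group of permutations of the disc. -/
def autDisc : Subgroup (Equiv.Perm 𝔻) where
  carrier := {γ | IsMobius γ}
  one_mem' := ⟨1, 0, by simp, fun z => by simp⟩
  mul_mem' := by
    rintro γ δ ⟨α, β, h, hγ⟩ ⟨α', β', h', hδ⟩
    refine ⟨α * α' + β * conj β', α * β' + β * conj α', ?_, fun z => ?_⟩
    · have e := normSq_identity α β h
      have e' := normSq_identity α' β' h'
      have : ((‖α * α' + β * conj β'‖ ^ 2 - ‖α * β' + β * conj α'‖ ^ 2 : ℝ) : ℂ) = 1 := by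
        push_cast
        rw [← Complex.mul_conj', ← Complex.mul_conj']
        simp only [map_add, map_mul, Complex.conj_conj]
        linear_combination (α' * conj α' - β' * conj β') * e + e'
      exact_mod_cast this
    · have d' := den_ne_zero α' β' h' z
      have d := den_ne_zero α β h (δ z)
      rw [Equiv.Perm.mul_apply, hγ]
      rw [hδ] at d ⊢
      have d'' : conj β * (α' * (z : ℂ) + β') + conj α * (conj β' * z + conj α') ≠ 0 := by
        intro h0
        apply d
        rw [mul_div_assoc', div_add' _ _ _ d', h0, zero_div]
      have : conj (α * β' + β * conj α') * (z : ℂ) + conj (α * α' + β * conj β') =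
          conj β * (α' * (z : ℂ) + β') + conj α * (conj β' * z + conj α') := by
        simp only [map_add, map_mul, Complex.conj_conj]; ring
      rw [this]
      have e1 : α * ((α' * (z : ℂ) + β') / (conj β' * z + conj α')) + β =
          (α * (α' * (z : ℂ) + β') + β * (conj β' * z + conj α')) / (conj β' * z + conj α') := by
        rw [mul_div_assoc', div_add' _ _ _ d']
      have e2 : conj β * ((α' * (z : ℂ) + β') / (conj β' * z + conj α')) + conj α =
          (conj β * (α' * (z : ℂ) + β') + conj α * (conj β' * z + conj α')) /
            (conj β' * z + conj α') := by
        rw [mul_div_assoc', div_add' _ _ _ d']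
      rw [e1, e2, div_div_div_cancel_right₀ d']
      ring
  inv_mem' := by
    rintro γ ⟨α, β, h, hγ⟩
    refine ⟨conj α, -β, by simpa using h, fun z => ?_⟩
    have e := normSq_identity α β h
    obtain ⟨y, rfl⟩ := γ.surjective z
    have d := den_ne_zero α β h y
    have d2 : conj (-β) * (γ y : ℂ) + conj (conj α) ≠ 0 :=
      den_ne_zero (conj α) (-β) (by simpa using h) (γ y)
    have hy : γ⁻¹ (γ y) = y := γ.symm_apply_apply y
    have hw := hγ y
    rw [eq_div_iff d] at hw
    rw [hy, eq_div_iff d2]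
    simp only [map_neg, Complex.conj_conj]
    linear_combination -hw

/-- `Γ` is a Fuchsian group, acting freely on the disc, with compact quotient. These are the
groups `Γ < Aut(𝔻)` for which `𝔻 / Γ` is a compact Riemann surface with universal covering
`𝔻 → 𝔻 / Γ`; the genus of `𝔻 / Γ` is then automatically at least two. -/
structure IsCompactSurfaceGroup (Γ : Subgroup (Equiv.Perm 𝔻)) : Prop where
  le_autDisc : Γ ≤ autDisc
  properlyDiscontinuous : ProperlyDiscontinuousSMul Γ 𝔻
  free : ∀ γ ∈ Γ, ∀ z : 𝔻, γ z = z → γ = 1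
  cocompact : CompactSpace (MulAction.orbitRel.Quotient Γ 𝔻)

/-- The pull-back of the `N`-differential `ψ(τ) dτ^{⊗N}` by `γ`, namely
`ψ(γ τ) γ'(τ)^N dτ^{⊗N}`; `N`-differentials on the disc are given by their coefficients. -/
def pullback (N : ℕ) (γ : 𝔻 → 𝔻) (ψ : 𝔻 → ℂ) : 𝔻 → ℂ :=
  fun τ => ψ (γ τ) * derivative γ τ ^ N

lemma extend_add (f g : 𝔻 → ℂ) : extend (f + g) = extend f + extend g := by
  funext z; by_cases h : ‖z‖ < 1 <;> simp [extend, h]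

lemma extend_smul (c : ℂ) (f : 𝔻 → ℂ) : extend (c • f) = c • extend f := by
  funext z; by_cases h : ‖z‖ < 1 <;> simp [extend, h]

lemma extend_zero : extend 0 = 0 := by
  funext z; by_cases h : ‖z‖ < 1 <;> simp [extend, h]

/-- `H⁰(Σ, K_Σ^{⊗N})` for `Σ = 𝔻 / Γ`: the holomorphic `N`-differentials on `Σ`, identified with
the `Γ`-invariant holomorphic `N`-differentials on the disc. -/
def holomorphicDifferentials (Γ : Subgroup (Equiv.Perm 𝔻)) (N : ℕ) : Submodule ℂ (𝔻 → ℂ) where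
  carrier := {ψ | Holomorphic ψ ∧ ∀ γ ∈ Γ, pullback N γ ψ = ψ}
  zero_mem' := by
    refine ⟨?_, fun γ _ => ?_⟩
    · simp only [Holomorphic, extend_zero]; exact differentiableOn_const 0
    · funext τ; simp [pullback]
  add_mem' := by
    rintro f g ⟨hf, hf'⟩ ⟨hg, hg'⟩
    refine ⟨?_, fun γ hγ => ?_⟩
    · simp only [Holomorphic, extend_add]; exact hf.add hg
    · have h1 := hf' γ hγ
      have h2 := hg' γ hγ
      funext τ
      have h1 := congrFun h1 τ
      have h2 := congrFun h2 τ
      simp only [pullback, Pi.add_apply] at h1 h2 ⊢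
      linear_combination h1 + h2
  smul_mem' := by
    rintro c f ⟨hf, hf'⟩
    refine ⟨?_, fun γ hγ => ?_⟩
    · simp only [Holomorphic, extend_smul]; exact hf.const_smul c
    · funext τ
      have h1 := congrFun (hf' γ hγ) τ
      simp only [pullback, Pi.smul_apply, smul_eq_mul] at h1 ⊢
      linear_combination c * h1

lemma one_sub_ne_zero (z w : 𝔻) : 1 - conj (z : ℂ) * w ≠ 0 := by
  intro h0
  have h1 : ‖conj (z : ℂ) * w‖ = 1 := by rw [← sub_eq_zero.1 h0]; simp
  rw [norm_mul, RCLike.norm_conj] at h1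
  nlinarith [z.norm_lt_one, w.norm_lt_one, norm_nonneg (z : ℂ), norm_nonneg (w : ℂ)]

/-- The coordinate `t = (w - z) / (1 - conj z w)` of `w`, centred at `z`. -/
def tCoord (z w : 𝔻) : ℂ := (w - z) / (1 - conj (z : ℂ) * w)

lemma norm_tCoord_le (z w : 𝔻) : ‖tCoord z w‖ ≤ 1 := by
  have hd := one_sub_ne_zero z w
  rw [tCoord, norm_div, div_le_one (norm_pos_iff.2 hd), ← abs_norm, ← abs_norm (1 - _),
    ← sq_le_sq]
  have key : ‖(1 - conj (z : ℂ) * w)‖ ^ 2 - ‖(w - z : ℂ)‖ ^ 2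
      = (1 - ‖(z : ℂ)‖ ^ 2) * (1 - ‖(w : ℂ)‖ ^ 2) := by
    have : ((‖(1 - conj (z : ℂ) * w)‖ ^ 2 - ‖(w - z : ℂ)‖ ^ 2 : ℝ) : ℂ)
      = ((1 - ‖(z : ℂ)‖ ^ 2) * (1 - ‖(w : ℂ)‖ ^ 2) : ℝ) := by
      push_cast
      simp only [← Complex.mul_conj', map_sub, map_mul, map_one, Complex.conj_conj]
      ring
    exact_mod_cast this
  have := mul_nonneg (sub_nonneg.2 z.sq_norm_lt_one.le) (sub_nonneg.2 w.sq_norm_lt_one.le)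
  linarith

lemma one_add_ne_zero (z w : 𝔻) (s : unitInterval) :
    1 + conj (z : ℂ) * ((s : ℝ) * tCoord z w) ≠ 0 := by
  intro h0
  have h1 : ‖conj (z : ℂ) * ((s : ℝ) * tCoord z w)‖ = 1 := by
    rw [← neg_eq_of_add_eq_zero_right h0]; simp
  rw [norm_mul, RCLike.norm_conj, norm_mul, Complex.norm_real, Real.norm_eq_abs,
    abs_of_nonneg s.2.1] at h1
  have h2 : (s : ℝ) * ‖tCoord z w‖ ≤ 1 :=
    mul_le_one₀ s.2.2 (norm_nonneg _) (norm_tCoord_le z w)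
  have h3 : ‖(z : ℂ)‖ * ((s : ℝ) * ‖tCoord z w‖) ≤ ‖(z : ℂ)‖ :=
    mul_le_of_le_one_right (norm_nonneg _) h2
  linarith [z.norm_lt_one]

/-- The geodesic segment of the Poincaré metric from `z` to `w`: the image of the radial segment
from `0` to `t = (w - z) / (1 - conj z w)` under the automorphism `t ↦ (t + z) / (1 + conj z t)`
of the disc. -/
def geodesic (z w : 𝔻) : Path (z : ℂ) (w : ℂ) where
  toFun s := ((s : ℝ) * tCoord z w + z) / (1 + conj (z : ℂ) * ((s : ℝ) * tCoord z w))
  continuous_toFun := by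
    refine Continuous.div ?_ ?_ (one_add_ne_zero z w)
    · fun_prop
    · fun_prop
  source' := by simp
  target' := by
    have hd := one_sub_ne_zero z w
    have h1 := one_add_ne_zero z w 1
    simp only [Set.Icc.coe_one, Complex.ofReal_one, one_mul] at h1 ⊢
    have ht : tCoord z w * (1 - conj (z : ℂ) * w) = w - z := div_mul_cancel₀ _ hd
    rw [div_eq_iff h1]
    linear_combination ht

/-- The coefficient of `dτ` in the meromorphic one-form
`[w, τ, z] = (w - z) dτ / ((w - τ) (τ - z))`. -/
def bracket (w τ z : ℂ) : ℂ := (w - z) / ((w - τ) * (τ - z))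

/-- The operator `I` on `H⁰(Σ, K_Σ^{⊗N})`. For `N ≥ 1` it is the integral of the one-form
`ψ(τ) dτ^{⊗N} / [w, τ, z]^{⊗(N-1)}` along the geodesic segment from `z` to `w`, divided by the
beta function `B(N, N)`. For `N = 0`, where `ψ` is a constant, it is that constant. -/
def I {Γ : Subgroup (Equiv.Perm 𝔻)} {N : ℕ} (ψ : holomorphicDifferentials Γ N) (z w : 𝔻) : ℂ :=
  if N = 0 then ψ.1 z
  else (1 / Complex.betaIntegral N N) *
    curveIntegral
      (fun τ : ℂ => (extend ψ.1 τ / bracket w τ z ^ (N - 1)) • ContinuousLinearMap.id ℂ ℂ)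
      (geodesic z w)

/-- The Poincaré series `∑_{γ ∈ Γ} γ^* dτ^{⊗N}`. -/
def poincareSeries (Γ : Subgroup (Equiv.Perm 𝔻)) (N : ℕ) : 𝔻 → ℂ :=
  fun τ => ∑' γ : Γ, pullback N (γ : Equiv.Perm 𝔻) (fun _ => 1) τ

end DiscQuotient

end

namespace DiscQuotient

open Filter Topology MeasureTheory

/-! A disc automorphism γ with denominator aτ + b has γ'(τ) = (aτ + b)⁻² and γw − γz = (w − z)/((aw
+ b)(az + b)). Hence (γw − γτ)(γτ − γz)/(γw − γz) = γ'(τ)(w − τ)(τ − z)/(w − z): the bracket is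
invariant. With m = γw − γz, the substitution M = γτ − γz turns the integral of γ^*dτ^N into m^(1−N)
∫ ((m − M)M)^(N−1) dM. This integrand is a polynomial, so the path is irrelevant, and the straight
segment from 0 to m gives m^N B(N,N) (`integral_den_mul_geodesicKernel`).

Convergence rests on 1 − |γ0|² = |b|⁻² and on ∑ |b|⁻⁴ < ∞ (`IsCompactSurfaceGroup.summable_sq`), an
area comparison: the translates of a small disc about 0 are disjoint and contain round discs of
radius comparable to |b|⁻². For N ≥ 2 all the series are dominated on compact sets by multiples of ∑
|b|⁻⁴. This gives locally uniform convergence, holomorphy and the exchange of sum and integral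
(`IsCompactSurfaceGroup.hasSum_I`); invariance is a reindexing of the sum. -/

/-! ### Disc automorphisms and their denominators -/

lemma extend_coe (f : 𝔻 → ℂ) (z : 𝔻) : extend f z = f z := by
  simp [extend, z.norm_lt_one]

lemma extend_of_norm_lt (f : 𝔻 → ℂ) {z : ℂ} (hz : ‖z‖ < 1) : extend f z = f (.mk z hz) := by
  simp [extend, hz]

lemma eventually_norm_lt_one {z : ℂ} (hz : ‖z‖ < 1) : ∀ᶠ u in 𝓝 z, ‖u‖ < 1 :=
  continuous_norm.continuousAt.eventually_lt continuousAt_const hz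

/-- The denominator `a z + b` of a disc automorphism stays away from zero. -/
lemma norm_den_ge {a b z : ℂ} (hab : ‖a‖ ≤ ‖b‖) : ‖b‖ * (1 - ‖z‖) ≤ ‖a * z + b‖ := by
  have h1 : ‖b‖ ≤ ‖a * z + b‖ + ‖a‖ * ‖z‖ := by
    rw [← norm_mul]
    simpa using norm_sub_le (a * z + b) (a * z)
  nlinarith [mul_le_mul_of_nonneg_right hab (norm_nonneg z)]

lemma den_ne_zero_of_norm_le {a b z : ℂ} (hab : ‖a‖ ≤ ‖b‖) (hb : 1 ≤ ‖b‖) (hz : ‖z‖ < 1) :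
    a * z + b ≠ 0 := by
  rw [← norm_pos_iff]
  exact lt_of_lt_of_le (mul_pos (by linarith) (by linarith)) (norm_den_ge hab)

/-- The coefficients of the denominator of a disc automorphism `γ`, together with the chord
formula and the derivative of `γ`. -/
lemma IsMobius.exists_den {γ : Equiv.Perm 𝔻} (hγ : IsMobius γ) :
    ∃ a b : ℂ, ‖a‖ ≤ ‖b‖ ∧ 1 ≤ ‖b‖ ∧ 1 - ‖(γ 0 : ℂ)‖ ^ 2 = (‖b‖ ^ 2)⁻¹ ∧
      (∀ z w : 𝔻, (γ w - γ z : ℂ) = (w - z) / ((a * w + b) * (a * z + b))) ∧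
      ∀ z : 𝔻, HasDerivAt (extend fun u => (γ u : ℂ)) (1 / (a * z + b) ^ 2) z := by
  obtain ⟨α, β, h, hγ⟩ := hγ
  have e := normSq_identity α β h
  have hn : ‖β‖ ≤ ‖α‖ := by nlinarith [norm_nonneg α, norm_nonneg β]
  have h1 : 1 ≤ ‖α‖ := by nlinarith [norm_nonneg α, norm_nonneg β]
  refine ⟨conj β, conj α, by simpa using hn, by simpa using h1, ?_, fun z w => ?_, fun z => ?_⟩
  · have : (γ 0 : ℂ) = β / conj α := by simp [hγ]
    rw [this, norm_div, RCLike.norm_conj]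
    field_simp
    linarith
  · have hz := den_ne_zero α β h z
    have hw := den_ne_zero α β h w
    rw [hγ, hγ, div_sub_div _ _ hw hz]
    congr 1
    linear_combination ((w : ℂ) - z) * e
  · have hz := den_ne_zero α β h z
    have : HasDerivAt (fun u : ℂ => (α * u + β) / (conj β * u + conj α))
        (1 / (conj β * z + conj α) ^ 2) z := by
      have h1 : HasDerivAt (fun u : ℂ => α * u + β) α z := by
        simpa using ((hasDerivAt_id (z : ℂ)).const_mul α).add_const β
      have h2 : HasDerivAt (fun u : ℂ => conj β * u + conj α) (conj β) z := by
        simpa using ((hasDerivAt_id (z : ℂ)).const_mul (conj β)).add_const (conj α)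
      refine (h1.fun_div h2 hz).congr_deriv ?_
      congr 1
      linear_combination e
    refine this.congr_of_eventuallyEq ?_
    filter_upwards [eventually_norm_lt_one z.norm_lt_one] with u hu
    rw [extend_of_norm_lt _ hu, hγ, Complex.UnitDisc.coe_mk]

/-- Since |b| ≥ 1 and n ≥ 2, the decay |b|⁻ⁿ may be weakened to |b|⁻²; a product of two such factors
is then of the summable order |b|⁻⁴. -/
lemma norm_inv_den_pow_le {a b z : ℂ} {R : ℝ} {n : ℕ} (hab : ‖a‖ ≤ ‖b‖) (hb : 1 ≤ ‖b‖)
    (hR : R < 1) (hz : ‖z‖ ≤ R) (hn : 2 ≤ n) :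
    ‖((a * z + b) ^ n)⁻¹‖ ≤ ((1 - R) ^ n)⁻¹ * (‖b‖ ^ 2)⁻¹ := by
  have h1 : ‖b‖ * (1 - R) ≤ ‖a * z + b‖ :=
    (mul_le_mul_of_nonneg_left (by linarith) (by linarith)).trans (norm_den_ge hab)
  have hR' : 0 < 1 - R := by linarith
  rw [norm_inv, norm_pow, ← mul_inv]
  refine inv_anti₀ (by positivity) ?_
  calc (1 - R) ^ n * ‖b‖ ^ 2 ≤ (1 - R) ^ n * ‖b‖ ^ n := by gcongr
    _ = (‖b‖ * (1 - R)) ^ n := by rw [mul_pow, mul_comm]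
    _ ≤ ‖a * z + b‖ ^ n := by gcongr

/-- The chord formula from 0 to z, with both denominators bounded below. The bound is uniform in γ.
-/
lemma IsMobius.norm_sub_le {γ : Equiv.Perm 𝔻} (hγ : IsMobius γ) (z : 𝔻) :
    ‖(γ z - γ 0 : ℂ)‖ * (1 - ‖(z : ℂ)‖) ≤ ‖(z : ℂ)‖ := by
  obtain ⟨a, b, hab, hb, -, h, -⟩ := hγ.exists_den
  have hz := norm_den_ge (z := (z : ℂ)) hab
  have h0 : 0 < ‖a * z + b‖ := norm_pos_iff.2 (den_ne_zero_of_norm_le hab hb z.norm_lt_one)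
  rw [h]
  simp only [Complex.UnitDisc.coe_zero, sub_zero, mul_zero, zero_add, norm_div, norm_mul]
  rw [div_mul_eq_mul_div, div_le_iff₀ (by positivity)]
  refine mul_le_mul_of_nonneg_left ?_ (norm_nonneg _)
  nlinarith [z.norm_lt_one]

/-- Opposite estimate, from |az + b| ≤ 2|b|: the image under γ of a disc about 0 contains a round
disc about γ0 of radius comparable to 1 − |γ0|². -/
lemma IsMobius.norm_le {γ : Equiv.Perm 𝔻} (hγ : IsMobius γ) (z : 𝔻) :
    ‖(z : ℂ)‖ * (1 - ‖(γ 0 : ℂ)‖ ^ 2) ≤ 2 * ‖(γ z - γ 0 : ℂ)‖ := by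
  obtain ⟨a, b, hab, hb, hk, h, -⟩ := hγ.exists_den
  have h0 : 0 < ‖a * z + b‖ := norm_pos_iff.2 (den_ne_zero_of_norm_le hab hb z.norm_lt_one)
  have h1 : ‖a * z + b‖ ≤ 2 * ‖b‖ := by
    refine (norm_add_le _ _).trans ?_
    rw [norm_mul]
    nlinarith [z.norm_lt_one, norm_nonneg a, norm_nonneg (z : ℂ)]
  rw [hk, h]
  simp only [Complex.UnitDisc.coe_zero, sub_zero, mul_zero, zero_add, norm_div, norm_mul]
  have hb0 : 0 < ‖b‖ := by linarith
  rw [← div_eq_mul_inv, ← mul_div_assoc, div_le_div_iff₀ (by positivity) (by positivity)]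
  nlinarith [mul_le_mul_of_nonneg_left h1 (mul_nonneg (norm_nonneg (z : ℂ)) hb0.le)]

lemma isCompact_norm_le {r : ℝ} (hr : r < 1) : IsCompact {z : 𝔻 | ‖(z : ℂ)‖ ≤ r} := by
  rw [Complex.UnitDisc.isEmbedding_coe.isCompact_iff]
  convert isCompact_closedBall (0 : ℂ) r using 1
  ext z
  simp only [Set.mem_image, Set.mem_ofPred_eq, mem_closedBall_zero_iff]
  exact ⟨by rintro ⟨y, hy, rfl⟩; exact hy, fun hz => ⟨.mk z (hz.trans_lt hr), hz, rfl⟩⟩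

/-! ### Convergence of the sum over the group -/

variable {Γ : Subgroup (Equiv.Perm 𝔻)} {N : ℕ}

lemma IsCompactSurfaceGroup.isMobius (hΓ : IsCompactSurfaceGroup Γ) (γ : Γ) :
    IsMobius (γ : Equiv.Perm 𝔻) := hΓ.le_autDisc γ.2

/-- The translates of a small disc centred at `0` are disjoint. -/
lemma IsCompactSurfaceGroup.exists_injective_disc (hΓ : IsCompactSurfaceGroup Γ) :
    ∃ r : ℝ, 0 < r ∧ r ≤ 1 ∧ ∀ γ : Γ, ∀ z : 𝔻, ‖(z : ℂ)‖ < r →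
      ‖((γ : Equiv.Perm 𝔻) z : ℂ)‖ < r → γ = 1 := by
  have hK := isCompact_norm_le (r := 1 / 2) (by norm_num)
  have hfin := hΓ.properlyDiscontinuous.finite_disjoint_inter_image hK hK
  -- If |z| and |γz| are below r < 1/2, then |γz − γ0| < 2r and so |γ0| < 3r. Only finitely many γ
  -- matter, and freeness gives γ0 ≠ 0 for γ ≠ 1.
  have hev : ∀ᶠ r : ℝ in 𝓝[>] 0, ∀ γ ∈ {γ : Γ | ((γ • ·) '' {z : 𝔻 | ‖(z : ℂ)‖ ≤ 1 / 2} ∩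
      {z : 𝔻 | ‖(z : ℂ)‖ ≤ 1 / 2}).Nonempty},
      γ ≠ 1 → 3 * r < ‖((γ : Equiv.Perm 𝔻) 0 : ℂ)‖ := by
    rw [Filter.eventually_all_finite hfin]
    intro γ _
    by_cases h1 : γ = 1
    · simp [h1]
    have h0 : 0 < ‖((γ : Equiv.Perm 𝔻) 0 : ℂ)‖ := by
      rw [norm_pos_iff, Ne, Complex.UnitDisc.coe_eq_zero]
      exact fun h => h1 (Subtype.ext (hΓ.free _ γ.2 0 h))
    filter_upwards [Ioo_mem_nhdsGT (show 0 < ‖((γ : Equiv.Perm 𝔻) 0 : ℂ)‖ / 3 by positivity)]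
      with r hr _
    linarith [hr.2]
  obtain ⟨r, hr, hr0, hr1⟩ := (hev.and (Ioo_mem_nhdsGT (show (0 : ℝ) < 1 / 2 by norm_num))).exists
  refine ⟨r, hr0, by linarith, fun γ z hz hγz => ?_⟩
  by_contra h1
  have h2 := hr γ ⟨γ • z, ⟨z, (hz.trans hr1).le, rfl⟩, (hγz.trans hr1).le⟩ h1
  have h3 := (hΓ.isMobius γ).norm_sub_le z
  have h4 : ‖((γ : Equiv.Perm 𝔻) 0 : ℂ)‖ ≤ ‖((γ : Equiv.Perm 𝔻) z : ℂ)‖ +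
      ‖((γ : Equiv.Perm 𝔻) z - (γ : Equiv.Perm 𝔻) 0 : ℂ)‖ := by
    simpa using _root_.norm_sub_le ((γ : Equiv.Perm 𝔻) z : ℂ)
      ((γ : Equiv.Perm 𝔻) z - (γ : Equiv.Perm 𝔻) 0 : ℂ)
  nlinarith [norm_nonneg ((γ : Equiv.Perm 𝔻) z - (γ : Equiv.Perm 𝔻) 0 : ℂ)]

/-- The series `∑ (1 - |γ 0|²)²` converges: comparison with the areas of disjoint discs. -/
lemma IsCompactSurfaceGroup.summable_sq (hΓ : IsCompactSurfaceGroup Γ) :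
    Summable fun γ : Γ => (1 - ‖((γ : Equiv.Perm 𝔻) 0 : ℂ)‖ ^ 2) ^ 2 := by
  obtain ⟨r, hr0, hr1, hr⟩ := hΓ.exists_injective_disc
  set κ : Γ → ℝ := fun γ => 1 - ‖((γ : Equiv.Perm 𝔻) 0 : ℂ)‖ ^ 2 with hκ
  have hκ0 : ∀ γ, 0 < κ γ := fun γ => sub_pos.2 ((γ : Equiv.Perm 𝔻) 0).sq_norm_lt_one
  -- The radius is chosen so that `IsMobius.norm_le` puts A γ inside the γ-translate of the disc of
  -- radius r; it is at most 1 − |γ0| because r ≤ 1.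
  set A : Γ → Set ℂ := fun γ => Metric.ball ((γ : Equiv.Perm 𝔻) 0 : ℂ) (r / 2 * κ γ)
  have hA : ∀ γ, ∀ u ∈ A γ, ‖u‖ < 1 := by
    intro γ u hu
    have h1 : ‖u - ((γ : Equiv.Perm 𝔻) 0 : ℂ)‖ < r / 2 * κ γ := mem_ball_iff_norm.1 hu
    have h2 := norm_le_norm_sub_add u ((γ : Equiv.Perm 𝔻) 0 : ℂ)
    have h3 := ((γ : Equiv.Perm 𝔻) 0).norm_lt_one
    have h4 : r / 2 * κ γ ≤ 1 / 2 * κ γ := by gcongr; exact (hκ0 γ).le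
    have h5 : κ γ = (1 - ‖((γ : Equiv.Perm 𝔻) 0 : ℂ)‖) * (1 + ‖((γ : Equiv.Perm 𝔻) 0 : ℂ)‖) := by
      rw [hκ]; ring
    nlinarith [norm_nonneg ((γ : Equiv.Perm 𝔻) 0 : ℂ)]
  have hpre : ∀ γ : Γ, ∀ u : 𝔻, (u : ℂ) ∈ A γ → ‖((γ : Equiv.Perm 𝔻)⁻¹ u : ℂ)‖ < r := by
    intro γ u hu
    have h1 : ‖u - ((γ : Equiv.Perm 𝔻) 0 : ℂ)‖ < r / 2 * κ γ := mem_ball_iff_norm.1 hu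
    have h2 := (hΓ.isMobius γ).norm_le ((γ : Equiv.Perm 𝔻)⁻¹ u)
    rw [show (γ : Equiv.Perm 𝔻) ((γ : Equiv.Perm 𝔻)⁻¹ u) = u from Equiv.apply_symm_apply _ u] at h2
    have h3 := hκ0 γ
    exact lt_of_mul_lt_mul_right (h2.trans_lt (by linarith : _ < r * κ γ)) h3.le
  have hdisj : Pairwise (Function.onFun Disjoint A) := by
    intro γ δ hne
    refine Set.disjoint_left.2 fun u hu hu' => hne ?_
    have h1 := hpre γ (.mk u (hA γ u hu)) hu
    have h2 := hpre δ (.mk u (hA γ u hu)) hu'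
    have h3 := hr (δ⁻¹ * γ) _ h1 (by simpa using h2)
    exact (inv_mul_eq_one.1 h3).symm
  -- Disjoint subsets of the unit disc have finite total area.
  have hfin : ∑' γ, volume (A γ) ≠ ⊤ := by
    refine ne_top_of_le_ne_top ?_ (tsum_meas_le_meas_iUnion_of_disjoint volume
      (fun γ => measurableSet_ball) hdisj)
    refine ne_top_of_le_ne_top (measure_ball_lt_top (x := (0 : ℂ)) (r := 1)).ne (measure_mono ?_)
    exact Set.iUnion_subset fun γ u hu => mem_ball_zero_iff.2 (hA γ u hu)
  have hs := ENNReal.summable_toReal hfin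
  have he : ∀ γ, (volume (A γ)).toReal = ((r / 2) ^ 2 * Real.pi) * κ γ ^ 2 := by
    intro γ
    rw [Complex.volume_ball, ENNReal.toReal_mul, ENNReal.toReal_pow,
      ENNReal.toReal_ofReal (mul_pos (by positivity) (hκ0 γ)).le, ENNReal.coe_toReal,
      NNReal.coe_real_pi]
    ring
  simp_rw [he] at hs
  exact (summable_mul_left_iff (by positivity)).1 hs

/-- A convergent series with no zero term has a countable index set. Dominated convergence over Γ
needs this. -/
lemma IsCompactSurfaceGroup.countable (hΓ : IsCompactSurfaceGroup Γ) : Countable Γ := by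
  have h := hΓ.summable_sq.countable_support
  have hu : Function.support (fun γ : Γ => (1 - ‖((γ : Equiv.Perm 𝔻) 0 : ℂ)‖ ^ 2) ^ 2) =
      Set.univ := by
    refine Set.eq_univ_of_forall fun γ => ?_
    exact pow_ne_zero 2 (sub_pos.2 ((γ : Equiv.Perm 𝔻) 0).sq_norm_lt_one).ne'
  rw [hu] at h
  exact Set.countable_univ_iff.1 h

lemma IsCompactSurfaceGroup.exists_den (hΓ : IsCompactSurfaceGroup Γ) :
    ∃ a b : Γ → ℂ, (∀ γ, ‖a γ‖ ≤ ‖b γ‖) ∧ (∀ γ, 1 ≤ ‖b γ‖) ∧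
      Summable (fun γ => ((‖b γ‖ ^ 2)⁻¹) ^ 2) ∧
      (∀ (γ : Γ) (z w : 𝔻), ((γ : Equiv.Perm 𝔻) w - (γ : Equiv.Perm 𝔻) z : ℂ) =
        (w - z) / ((a γ * w + b γ) * (a γ * z + b γ))) ∧
      ∀ (γ : Γ) (z : 𝔻), derivative (γ : Equiv.Perm 𝔻) z = 1 / (a γ * z + b γ) ^ 2 := by
  choose a b h1 h2 h3 h4 h5 using fun γ : Γ => (hΓ.isMobius γ).exists_den
  refine ⟨a, b, h1, h2, ?_, h4, fun γ z => (h5 γ z).deriv⟩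
  simpa only [h3] using hΓ.summable_sq

/-! ### The Poincaré series -/

lemma norm_one_div_den_pow_le {a b z : ℂ} {R : ℝ} (hab : ‖a‖ ≤ ‖b‖) (hb : 1 ≤ ‖b‖)
    (hR : R < 1) (hz : ‖z‖ ≤ R) (hN : 2 ≤ N) :
    ‖(1 / (a * z + b) ^ 2) ^ N‖ ≤ (((1 - R) ^ N)⁻¹) ^ 2 * ((‖b‖ ^ 2)⁻¹) ^ 2 := by
  have h := norm_inv_den_pow_le hab hb hR hz hN
  have e : (1 / (a * z + b) ^ 2) ^ N = (((a * z + b) ^ N)⁻¹) ^ 2 := by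
    rw [one_div, inv_pow, inv_pow, ← pow_mul, ← pow_mul, mul_comm 2 N]
  rw [e, norm_pow, ← mul_pow]
  gcongr

lemma IsCompactSurfaceGroup.hasSumLocallyUniformly (hΓ : IsCompactSurfaceGroup Γ) (hN : 2 ≤ N) :
    HasSumLocallyUniformly
      (fun (γ : Γ) (τ : 𝔻) => pullback N (γ : Equiv.Perm 𝔻) (fun _ => 1) τ)
      (poincareSeries Γ N) := by
  obtain ⟨a, b, hab, hb, hs, -, hd⟩ := hΓ.exists_den
  intro u hu x
  obtain ⟨R, hxR, hR⟩ := exists_between x.norm_lt_one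
  refine ⟨{z : 𝔻 | ‖(z : ℂ)‖ < R}, (isOpen_lt (by fun_prop) continuous_const).mem_nhds hxR, ?_⟩
  refine tendstoUniformlyOn_tsum (hs.mul_left ((((1 - R) ^ N)⁻¹) ^ 2)) (fun γ z hz => ?_) u hu
  simp only [pullback, one_mul, hd]
  exact norm_one_div_den_pow_le (hab γ) (hb γ) hR (le_of_lt hz) hN

/-- The chain rule, which makes γ' a cocycle and gives the invariance of the Poincaré series. -/
lemma derivative_mul {γ δ : Equiv.Perm 𝔻} (hγ : IsMobius γ) (hδ : IsMobius δ) (z : 𝔻) :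
    derivative (δ * γ : Equiv.Perm 𝔻) z = derivative δ (γ z) * derivative γ z := by
  obtain ⟨a, b, -, -, -, -, h⟩ := hγ.exists_den
  obtain ⟨c, d, -, -, -, -, h'⟩ := hδ.exists_den
  have h2 := h' (γ z)
  rw [← extend_coe (fun u => (γ u : ℂ)) z] at h2
  have hcomp := h2.comp (z : ℂ) (h z)
  rw [extend_coe (fun u => (γ u : ℂ)) z, ← (h z).deriv, ← (h' (γ z)).deriv] at hcomp
  refine HasDerivAt.deriv (hcomp.congr_of_eventuallyEq ?_)
  filter_upwards [eventually_norm_lt_one z.norm_lt_one] with u hu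
  rw [Function.comp_apply, extend_of_norm_lt _ hu, extend_of_norm_lt _ hu, extend_coe,
    Equiv.Perm.mul_apply]

lemma IsCompactSurfaceGroup.poincareSeries_mem (hΓ : IsCompactSurfaceGroup Γ) (hN : 2 ≤ N) :
    poincareSeries Γ N ∈ holomorphicDifferentials Γ N := by
  obtain ⟨a, b, hab, hb, hs, -, hd⟩ := hΓ.exists_den
  refine ⟨fun z hz => ?_, fun γ hγ => ?_⟩
  · obtain ⟨R, hzR, hR⟩ := exists_between (mem_ball_zero_iff.1 hz)
    have hlt : ∀ u ∈ Metric.ball (0 : ℂ) R, ‖u‖ < R := fun u hu => mem_ball_zero_iff.1 hu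
    have hdiff : DifferentiableOn ℂ (fun u : ℂ => ∑' γ : Γ, (1 / (a γ * u + b γ) ^ 2) ^ N)
        (Metric.ball 0 R) := by
      refine Complex.differentiableOn_tsum_of_summable_norm
        (hs.mul_left ((((1 - R) ^ N)⁻¹) ^ 2)) (fun γ u hu => ?_) Metric.isOpen_ball
        fun γ u hu => norm_one_div_den_pow_le (hab γ) (hb γ) hR (hlt u hu).le hN
      have h0 := den_ne_zero_of_norm_le (hab γ) (hb γ) ((hlt u hu).trans hR)
      have h1 : DifferentiableAt ℂ (fun u : ℂ => (a γ * u + b γ) ^ 2) u := by fun_prop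
      exact (((differentiableAt_const _).fun_div h1 (pow_ne_zero 2 h0)).fun_pow
        N).differentiableWithinAt
    have hmem : z ∈ Metric.ball (0 : ℂ) R := mem_ball_zero_iff.2 hzR
    have hnhds := Metric.isOpen_ball.mem_nhds hmem
    refine DifferentiableAt.differentiableWithinAt ?_
    refine (hdiff.differentiableAt hnhds).congr_of_eventuallyEq ?_
    filter_upwards [hnhds] with u hu
    have hu1 : ‖u‖ < 1 := (hlt u hu).trans hR
    simp [extend_of_norm_lt _ hu1, poincareSeries, pullback, hd]
  · funext τ
    -- Pulling back by γ permutes the terms through δ ↦ δγ.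
    rw [pullback, poincareSeries, poincareSeries, ← tsum_mul_right,
      ← (Equiv.mulRight (⟨γ, hγ⟩ : Γ)).tsum_eq
        fun δ : Γ => pullback N (δ : Equiv.Perm 𝔻) (fun _ => 1) τ]
    refine tsum_congr fun δ => ?_
    simp only [pullback, one_mul, Equiv.coe_mulRight, Subgroup.coe_mul]
    rw [derivative_mul (hΓ.le_autDisc hγ) (hΓ.isMobius δ), mul_pow]

/-! ### The series of powers of chords -/

lemma IsCompactSurfaceGroup.summable_chord_pow (hΓ : IsCompactSurfaceGroup Γ) (hN : 2 ≤ N)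
    (z w : 𝔻) : Summable fun γ : Γ =>
      ((γ : Equiv.Perm 𝔻) w - (γ : Equiv.Perm 𝔻) z : ℂ) ^ N := by
  obtain ⟨a, b, hab, hb, hs, hc, -⟩ := hΓ.exists_den
  refine Summable.of_norm_bounded
    (hs.mul_left (‖(w - z : ℂ)‖ ^ N * (((1 - ‖(w : ℂ)‖) ^ N)⁻¹ * ((1 - ‖(z : ℂ)‖) ^ N)⁻¹)))
    fun γ => ?_
  have h1 := norm_inv_den_pow_le (hab γ) (hb γ) w.norm_lt_one le_rfl hN
  have h2 := norm_inv_den_pow_le (hab γ) (hb γ) z.norm_lt_one le_rfl hN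
  rw [hc, div_eq_mul_inv, mul_pow, inv_pow, mul_pow, mul_inv, norm_mul, norm_mul, norm_pow,
    mul_assoc]
  refine mul_le_mul_of_nonneg_left ?_ (by positivity)
  refine (mul_le_mul h1 h2 (norm_nonneg _) ((norm_nonneg _).trans h1)).trans_eq ?_
  ring

lemma tsum_chord_pow_invariant (N : ℕ) {γ : Equiv.Perm 𝔻} (hγ : γ ∈ Γ) (z w : 𝔻) :
    ∑' δ : Γ, ((δ : Equiv.Perm 𝔻) (γ w) - (δ : Equiv.Perm 𝔻) (γ z) : ℂ) ^ N =
      ∑' δ : Γ, ((δ : Equiv.Perm 𝔻) w - (δ : Equiv.Perm 𝔻) z : ℂ) ^ N :=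
  (Equiv.mulRight (⟨γ, hγ⟩ : Γ)).tsum_eq
    fun δ : Γ => ((δ : Equiv.Perm 𝔻) w - (δ : Equiv.Perm 𝔻) z : ℂ) ^ N

lemma hasDerivAt_inv_den_pow {a b u : ℂ} (n : ℕ) (h : a * u + b ≠ 0) :
    HasDerivAt (fun u : ℂ => ((a * u + b) ^ n)⁻¹) (-(n * a) * ((a * u + b) ^ (n + 1))⁻¹) u := by
  have h1 : HasDerivAt (fun u : ℂ => a * u + b) a u := by
    simpa using ((hasDerivAt_id u).const_mul a).add_const b
  refine ((h1.fun_pow n).fun_inv (pow_ne_zero n h)).congr_deriv ?_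
  rcases n with _ | n
  · simp
  · rw [Nat.add_sub_cancel]
    field_simp
    ring

/-- Differentiation costs only a factor n|a|/|az + b| ≤ n/(1 − R), so the order |b|⁻² survives. -/
lemma norm_deriv_inv_den_pow_le {a b z : ℂ} {R : ℝ} {n : ℕ} (hab : ‖a‖ ≤ ‖b‖) (hb : 1 ≤ ‖b‖)
    (hR : R < 1) (hz : ‖z‖ ≤ R) (hn : 2 ≤ n) :
    ‖-(n * a) * ((a * z + b) ^ (n + 1))⁻¹‖ ≤ n * ((1 - R) ^ (n + 1))⁻¹ * (‖b‖ ^ 2)⁻¹ := by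
  have h1 := norm_inv_den_pow_le hab hb hR hz hn
  have hR' : 0 < 1 - R := by linarith
  have h2 : ‖b‖ * (1 - R) ≤ ‖a * z + b‖ :=
    (mul_le_mul_of_nonneg_left (by linarith) (by linarith)).trans (norm_den_ge hab)
  have hb0 : 0 < ‖b‖ := by linarith
  have h3 : ‖a‖ * ‖a * z + b‖⁻¹ ≤ (1 - R)⁻¹ := by
    rw [← div_eq_mul_inv, inv_eq_one_div, div_le_div_iff₀ (lt_of_lt_of_le (by positivity) h2) hR']
    nlinarith
  calc ‖-(n * a) * ((a * z + b) ^ (n + 1))⁻¹‖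
      = n * ((‖a‖ * ‖a * z + b‖⁻¹) * ‖((a * z + b) ^ n)⁻¹‖) := by
        rw [pow_succ, mul_inv, norm_mul, norm_neg, norm_mul, norm_mul, norm_inv (a * z + b),
          RCLike.norm_natCast]
        ring
    _ ≤ n * ((1 - R)⁻¹ * (((1 - R) ^ n)⁻¹ * (‖b‖ ^ 2)⁻¹)) := by gcongr
    _ = n * ((1 - R) ^ (n + 1))⁻¹ * (‖b‖ ^ 2)⁻¹ := by
        rw [pow_succ (1 - R), mul_inv]; ring

/-- The factor (w − z)^N comes out of the sum. What remains is a series of products A(z)A(w), whose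
differentials are bounded on a smaller bidisc by multiples of |b|⁻⁴, so it may be differentiated
term by term. -/
lemma IsCompactSurfaceGroup.holomorphic₂_tsum (hΓ : IsCompactSurfaceGroup Γ) (hN : 2 ≤ N) :
    Holomorphic₂ fun z w => ∑' γ : Γ,
      ((γ : Equiv.Perm 𝔻) w - (γ : Equiv.Perm 𝔻) z : ℂ) ^ N := by
  obtain ⟨a, b, hab, hb, hs, hc, -⟩ := hΓ.exists_den
  rintro p ⟨hp1, hp2⟩
  obtain ⟨R, hpR, hR⟩ := exists_between
    (max_lt (mem_ball_zero_iff.1 hp1) (mem_ball_zero_iff.1 hp2))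
  set U : Set (ℂ × ℂ) := Metric.ball 0 R ×ˢ Metric.ball 0 R
  have hU : IsOpen U := Metric.isOpen_ball.prod Metric.isOpen_ball
  have hpU : p ∈ U := ⟨mem_ball_zero_iff.2 ((le_max_left _ _).trans_lt hpR),
    mem_ball_zero_iff.2 ((le_max_right _ _).trans_lt hpR)⟩
  have hUc : IsPreconnected U :=
    ((convex_ball (0 : ℂ) R).prod (convex_ball (0 : ℂ) R)).isPreconnected
  have hU1 : ∀ q ∈ U, ‖q.1‖ < R := fun q hq => mem_ball_zero_iff.1 hq.1
  have hU2 : ∀ q ∈ U, ‖q.2‖ < R := fun q hq => mem_ball_zero_iff.1 hq.2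
  have hR0 : 0 < 1 - R := by linarith
  set A : Γ → ℂ → ℂ := fun γ u => ((a γ * u + b γ) ^ N)⁻¹
  set A' : Γ → ℂ → ℂ := fun γ u => -(N * a γ) * ((a γ * u + b γ) ^ (N + 1))⁻¹
  set D : Γ → ℂ × ℂ → ℂ × ℂ →L[ℂ] ℂ := fun γ q =>
    A γ q.2 • A' γ q.1 • ContinuousLinearMap.fst ℂ ℂ ℂ +
      A γ q.1 • A' γ q.2 • ContinuousLinearMap.snd ℂ ℂ ℂ with hD
  have hA : ∀ γ u, ‖u‖ < R → ‖A γ u‖ ≤ ((1 - R) ^ N)⁻¹ * (‖b γ‖ ^ 2)⁻¹ := fun γ u hu =>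
    norm_inv_den_pow_le (hab γ) (hb γ) hR hu.le hN
  have hA' : ∀ γ u, ‖u‖ < R → ‖A' γ u‖ ≤ N * ((1 - R) ^ (N + 1))⁻¹ * (‖b γ‖ ^ 2)⁻¹ :=
    fun γ u hu => norm_deriv_inv_den_pow_le (hab γ) (hb γ) hR hu.le hN
  have hderiv : ∀ γ, ∀ q ∈ U, HasFDerivAt (fun q : ℂ × ℂ => A γ q.1 * A γ q.2) (D γ q) q := by
    intro γ q hq
    have h1 := (hasDerivAt_inv_den_pow N (den_ne_zero_of_norm_le (hab γ) (hb γ)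
      ((hU1 q hq).trans hR))).comp_hasFDerivAt q (hasFDerivAt_fst (𝕜 := ℂ) (p := q))
    have h2 := (hasDerivAt_inv_den_pow N (den_ne_zero_of_norm_le (hab γ) (hb γ)
      ((hU2 q hq).trans hR))).comp_hasFDerivAt q (hasFDerivAt_snd (𝕜 := ℂ) (p := q))
    refine (h1.mul h2).congr_fderiv ?_
    rw [hD, add_comm]
    rfl
  have hbound : ∀ γ, ∀ q ∈ U, ‖D γ q‖ ≤
      2 * (((1 - R) ^ N)⁻¹ * (N * ((1 - R) ^ (N + 1))⁻¹)) * ((‖b γ‖ ^ 2)⁻¹) ^ 2 := by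
    intro γ q hq
    have key : ∀ (x y : ℂ) (L : ℂ × ℂ →L[ℂ] ℂ), ‖x‖ < R → ‖y‖ < R → ‖L‖ ≤ 1 →
        ‖A γ x • A' γ y • L‖ ≤
          ((1 - R) ^ N)⁻¹ * (‖b γ‖ ^ 2)⁻¹ * (N * ((1 - R) ^ (N + 1))⁻¹ * (‖b γ‖ ^ 2)⁻¹) := by
      intro x y L hx hy hL
      rw [norm_smul, norm_smul]
      refine mul_le_mul (hA γ x hx) ?_ (by positivity) (by positivity)
      exact (mul_le_of_le_one_right (norm_nonneg _) hL).trans (hA' γ y hy)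
    refine (norm_add_le _ _).trans ((add_le_add
      (key q.2 q.1 _ (hU2 q hq) (hU1 q hq) (ContinuousLinearMap.norm_fst_le ℂ ℂ ℂ))
      (key q.1 q.2 _ (hU1 q hq) (hU2 q hq) (ContinuousLinearMap.norm_snd_le ℂ ℂ ℂ))).trans_eq ?_)
    ring
  have hsum : Summable fun γ => A γ p.1 * A γ p.2 := by
    refine Summable.of_norm_bounded (hs.mul_left ((((1 - R) ^ N)⁻¹) ^ 2)) fun γ => ?_
    rw [norm_mul]
    refine (mul_le_mul (hA γ _ (hU1 p hpU)) (hA γ _ (hU2 p hpU)) (norm_nonneg _)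
      (by positivity)).trans_eq ?_
    ring
  have hF := hasFDerivAt_tsum_of_isPreconnected (hs.mul_left _) hU hUc hderiv hbound hpU hsum hpU
  have hG : DifferentiableAt ℂ
      (fun q : ℂ × ℂ => (q.2 - q.1) ^ N * ∑' γ, A γ q.1 * A γ q.2) p :=
    DifferentiableAt.fun_mul (by fun_prop) hF.differentiableAt
  refine DifferentiableAt.differentiableWithinAt (hG.congr_of_eventuallyEq ?_)
  filter_upwards [hU.mem_nhds hpU] with q hq
  rw [extend_of_norm_lt _ ((hU1 q hq).trans hR), extend_of_norm_lt _ ((hU2 q hq).trans hR),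
    ← tsum_mul_left]
  refine tsum_congr fun γ => ?_
  rw [hc, div_eq_mul_inv, mul_pow, inv_pow, mul_pow, mul_inv, mul_comm (_ ^ N)⁻¹]
  rfl

/-! ### Path independence and the beta integral -/

lemma exists_derivative_eq (p : Polynomial ℂ) : ∃ q : Polynomial ℂ, q.derivative = p := by
  induction p using Polynomial.induction_on' with
  | add p q hp hq =>
    obtain ⟨p', rfl⟩ := hp
    obtain ⟨q', rfl⟩ := hq
    exact ⟨p' + q', Polynomial.derivative_add⟩
  | monomial n c =>
    refine ⟨Polynomial.monomial (n + 1) (c / (n + 1)), ?_⟩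
    rw [Polynomial.derivative_monomial, Nat.add_sub_cancel, Nat.cast_add_one,
      div_mul_cancel₀ _ (Nat.cast_add_one_ne_zero n)]

/-- The integral of `p(M) dM` depends only on the end points of the path `M`. -/
lemma integral_polynomial_comp_mul_deriv (p : Polynomial ℂ) {M₁ M₁' M₂ M₂' : ℝ → ℂ}
    (h₁ : ∀ s ∈ Set.Icc (0 : ℝ) 1, HasDerivAt M₁ (M₁' s) s)
    (h₂ : ∀ s ∈ Set.Icc (0 : ℝ) 1, HasDerivAt M₂ (M₂' s) s)
    (c₁ : ContinuousOn M₁' (Set.Icc 0 1)) (c₂ : ContinuousOn M₂' (Set.Icc 0 1))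
    (e0 : M₁ 0 = M₂ 0) (e1 : M₁ 1 = M₂ 1) :
    ∫ s in (0 : ℝ)..1, p.eval (M₁ s) * M₁' s = ∫ s in (0 : ℝ)..1, p.eval (M₂ s) * M₂' s := by
  obtain ⟨q, rfl⟩ := exists_derivative_eq p
  have key : ∀ M M' : ℝ → ℂ, (∀ s ∈ Set.Icc (0 : ℝ) 1, HasDerivAt M (M' s) s) →
      ContinuousOn M' (Set.Icc 0 1) →
      ∫ s in (0 : ℝ)..1, q.derivative.eval (M s) * M' s = q.eval (M 1) - q.eval (M 0) := by
    intro M M' h c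
    rw [← Set.uIcc_of_le zero_le_one] at h c
    have hc : ContinuousOn M (Set.uIcc 0 1) := fun s hs =>
      (h s hs).continuousAt.continuousWithinAt
    refine intervalIntegral.integral_eq_sub_of_hasDerivAt (f := fun s => q.eval (M s))
      (fun s hs => ?_) ?_
    · exact (q.hasDerivAt (M s)).comp s (h s hs)
    · exact ((q.derivative.continuous.comp_continuousOn hc).mul c).intervalIntegrable
  rw [key _ _ h₁ c₁, key _ _ h₂ c₂, e0, e1]

lemma betaIntegral_nat_succ (n : ℕ) :
    Complex.betaIntegral (n + 1 : ℕ) (n + 1 : ℕ) =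
      ∫ s in (0 : ℝ)..1, ((1 - (s : ℂ)) * s) ^ n := by
  rw [Complex.betaIntegral]
  refine intervalIntegral.integral_congr fun s _ => ?_
  simp only [Nat.cast_add_one, add_sub_cancel_right, Complex.cpow_natCast]
  rw [mul_pow, mul_comm]

lemma betaIntegral_nat_ne_zero {N : ℕ} (hN : N ≠ 0) : Complex.betaIntegral N N ≠ 0 := by
  have h0 : 0 < (N : ℂ).re := by simpa using Nat.pos_of_ne_zero hN
  have h := Complex.Gamma_mul_Gamma_eq_betaIntegral h0 h0
  have hg := Complex.Gamma_ne_zero_of_re_pos h0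
  intro hb
  rw [hb, mul_zero] at h
  exact mul_ne_zero hg hg h

/-- The beta integral along an arbitrary path. -/
lemma integral_chord_pow {M M' : ℝ → ℂ} (n : ℕ)
    (h : ∀ s ∈ Set.Icc (0 : ℝ) 1, HasDerivAt M (M' s) s) (c : ContinuousOn M' (Set.Icc 0 1)) :
    ∫ s in (0 : ℝ)..1, ((M 1 - M s) * (M s - M 0)) ^ n * M' s =
      (M 1 - M 0) ^ (2 * n + 1) * Complex.betaIntegral (n + 1 : ℕ) (n + 1 : ℕ) := by
  -- The path is replaced by the straight segment with the same end points, where the integral is a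
  -- beta integral.
  have hline : ∀ s : ℝ, HasDerivAt (fun s : ℝ => M 0 + (M 1 - M 0) * (s : ℂ)) (M 1 - M 0) s :=
    fun s => by
      simpa using ((Complex.ofRealCLM.hasDerivAt (x := s)).const_mul (M 1 - M 0)).const_add (M 0)
  have key := integral_polynomial_comp_mul_deriv
    (((Polynomial.C (M 1) - Polynomial.X) * (Polynomial.X - Polynomial.C (M 0))) ^ n)
    h (fun s _ => hline s) c continuousOn_const (by simp) (by simp)
  simp only [Polynomial.eval_pow, Polynomial.eval_mul, Polynomial.eval_sub, Polynomial.eval_C,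
    Polynomial.eval_X] at key
  rw [key, betaIntegral_nat_succ, ← intervalIntegral.integral_const_mul]
  refine intervalIntegral.integral_congr fun s _ => ?_
  rw [show (M 1 - (M 0 + (M 1 - M 0) * (s : ℂ))) * (M 0 + (M 1 - M 0) * s - M 0) =
    (M 1 - M 0) ^ 2 * ((1 - (s : ℂ)) * s) by ring, mul_pow, ← pow_mul]
  ring

/-! ### The integral along a geodesic segment -/

/-- Strict form of `norm_tCoord_le`, for complex numbers so that it also applies with −z in place of
z, which gives the points of the geodesic. -/
lemma norm_disc_sub_div_lt_one {z v : ℂ} (hz : ‖z‖ < 1) (hv : ‖v‖ < 1) :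
    ‖(v - z) / (1 - conj z * v)‖ < 1 := by
  have key : ‖1 - conj z * v‖ ^ 2 - ‖v - z‖ ^ 2 = (1 - ‖z‖ ^ 2) * (1 - ‖v‖ ^ 2) := by
    have : ((‖1 - conj z * v‖ ^ 2 - ‖v - z‖ ^ 2 : ℝ) : ℂ) =
        ((1 - ‖z‖ ^ 2) * (1 - ‖v‖ ^ 2) : ℝ) := by
      push_cast
      simp only [← Complex.mul_conj', map_sub, map_mul, map_one, Complex.conj_conj]
      ring
    exact_mod_cast this
  have hz2 : ‖z‖ ^ 2 < 1 := by nlinarith [norm_nonneg z]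
  have hv2 : ‖v‖ ^ 2 < 1 := by nlinarith [norm_nonneg v]
  have hpos := mul_pos (sub_pos.2 hz2) (sub_pos.2 hv2)
  have hlt : ‖v - z‖ < ‖1 - conj z * v‖ := lt_of_pow_lt_pow_left₀ 2 (norm_nonneg _) (by linarith)
  rw [norm_div, div_lt_one ((norm_nonneg _).trans_lt hlt)]
  exact hlt

/-- The parametrization of the geodesic segment from `z` to `w`. -/
noncomputable def geodesicFun (z w : 𝔻) (s : ℝ) : ℂ :=
  (s * tCoord z w + z) / (1 + conj (z : ℂ) * (s * tCoord z w))

/-- The velocity of the parametrization of the geodesic segment from `z` to `w`. -/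
noncomputable def geodesicVel (z w : 𝔻) (s : ℝ) : ℂ :=
  tCoord z w * (1 - conj (z : ℂ) * z) / (1 + conj (z : ℂ) * (s * tCoord z w)) ^ 2

section Geodesic

variable (z w : 𝔻)

lemma geodesicFun_zero : geodesicFun z w 0 = z := by simp [geodesicFun]

lemma geodesicFun_one : geodesicFun z w 1 = w := (geodesic z w).target

variable {s : ℝ}

lemma extend_geodesic (hs : s ∈ Set.Icc (0 : ℝ) 1) :
    (geodesic z w).extend s = geodesicFun z w s := by
  rw [Path.extend_apply _ hs]
  rfl

lemma norm_geodesicFun_lt_one (hs : s ∈ Set.Icc (0 : ℝ) 1) : ‖geodesicFun z w s‖ < 1 := by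
  have ht : ‖(s : ℂ) * tCoord z w‖ < 1 := by
    rw [norm_mul, Complex.norm_real, Real.norm_of_nonneg hs.1]
    exact (mul_le_of_le_one_left (norm_nonneg _) hs.2).trans_lt
      (norm_disc_sub_div_lt_one z.norm_lt_one w.norm_lt_one)
  simpa [geodesicFun] using norm_disc_sub_div_lt_one (z := -(z : ℂ)) (by simpa using z.norm_lt_one) ht

lemma hasDerivAt_geodesicFun (hs : s ∈ Set.Icc (0 : ℝ) 1) :
    HasDerivAt (geodesicFun z w) (geodesicVel z w s) s := by
  have h0 := one_add_ne_zero z w ⟨s, hs⟩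
  have h1 : HasDerivAt (fun s : ℝ => (s : ℂ) * tCoord z w) (tCoord z w) s := by
    simpa using (Complex.ofRealCLM.hasDerivAt (x := s)).mul_const (tCoord z w)
  refine ((h1.add_const (z : ℂ)).fun_div ((h1.const_mul (conj (z : ℂ))).const_add 1)
    h0).congr_deriv ?_
  rw [geodesicVel]
  congr 1
  ring

lemma continuousOn_geodesicFun : ContinuousOn (geodesicFun z w) (Set.Icc 0 1) :=
  fun _ hs => (hasDerivAt_geodesicFun z w hs).continuousAt.continuousWithinAt

lemma continuousOn_geodesicVel : ContinuousOn (geodesicVel z w) (Set.Icc 0 1) :=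
  ContinuousOn.div (by fun_prop) (by fun_prop)
    fun s hs => pow_ne_zero 2 (one_add_ne_zero z w ⟨s, hs⟩)

lemma deriv_extend_geodesic (hs : s ∈ Set.Ioo (0 : ℝ) 1) :
    deriv (geodesic z w).extend s = geodesicVel z w s := by
  refine HasDerivAt.deriv ((hasDerivAt_geodesicFun z w
    (Set.Ioo_subset_Icc_self hs)).congr_of_eventuallyEq ?_)
  filter_upwards [isOpen_Ioo.mem_nhds hs] with u hu
  exact extend_geodesic z w (Set.Ioo_subset_Icc_self hu)

lemma exists_norm_geodesicFun_le :
    ∃ R < 1, ∀ s ∈ Set.Icc (0 : ℝ) 1, ‖geodesicFun z w s‖ ≤ R := by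
  obtain ⟨s, hs, h⟩ := isCompact_Icc.exists_isMaxOn (Set.nonempty_Icc.2 (zero_le_one' ℝ))
    (continuousOn_geodesicFun z w).norm
  exact ⟨_, norm_geodesicFun_lt_one z w hs, fun u hu => h hu⟩

/-- The coefficient `[w, τ, z]^{-n} dτ` of the operator `I` along the geodesic segment. -/
noncomputable def geodesicKernel (n : ℕ) (s : ℝ) : ℂ :=
  ((w - geodesicFun z w s) * (geodesicFun z w s - z) / (w - z)) ^ n * geodesicVel z w s

lemma continuousOn_geodesicKernel (n : ℕ) : ContinuousOn (geodesicKernel z w n) (Set.Icc 0 1) :=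
  ((((continuousOn_const.sub (continuousOn_geodesicFun z w)).mul
    ((continuousOn_geodesicFun z w).sub continuousOn_const)).div_const _).pow n).mul
    (continuousOn_geodesicVel z w)

/-- The value of `I` on the pull-back of `dτ^{⊗(n+1)}` by a disc automorphism with denominator
`a τ + b`. -/
lemma integral_den_mul_geodesicKernel {a b : ℂ} (hab : ‖a‖ ≤ ‖b‖) (hb : 1 ≤ ‖b‖) (n : ℕ) :
    ∫ s in (0 : ℝ)..1, (1 / (a * geodesicFun z w s + b) ^ 2) ^ (n + 1) * geodesicKernel z w n s =
      Complex.betaIntegral (n + 1 : ℕ) (n + 1 : ℕ) *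
        ((w - z) / ((a * w + b) * (a * z + b))) ^ (n + 1) := by
  rcases eq_or_ne z w with rfl | hzw
  -- On the diagonal the velocity vanishes, and so does the right-hand side because its exponent is
  -- positive.
  · simp [geodesicKernel, geodesicVel, tCoord]
  have hd : (w - z : ℂ) ≠ 0 := sub_ne_zero.2 fun h => hzw (Complex.UnitDisc.coe_injective h).symm
  have hz := den_ne_zero_of_norm_le hab hb z.norm_lt_one
  have hw := den_ne_zero_of_norm_le hab hb w.norm_lt_one
  have hden : ∀ s ∈ Set.Icc (0 : ℝ) 1, a * geodesicFun z w s + b ≠ 0 := fun s hs =>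
    den_ne_zero_of_norm_le hab hb (norm_geodesicFun_lt_one z w hs)
  -- By the chord formula this path is γτ − γz, written with a and b only; its velocity is γ'(τ) dτ.
  have hM : ∀ s ∈ Set.Icc (0 : ℝ) 1, HasDerivAt
      (fun s => (geodesicFun z w s - z) / ((a * geodesicFun z w s + b) * (a * z + b)))
      (geodesicVel z w s / (a * geodesicFun z w s + b) ^ 2) s := by
    intro s hs
    have h := hasDerivAt_geodesicFun z w hs
    refine ((h.sub_const (z : ℂ)).fun_div (((h.const_mul a).add_const b).mul_const (a * z + b))
      (mul_ne_zero (hden s hs) hz)).congr_deriv ?_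
    have := hden s hs
    field_simp
    ring
  have hc : ContinuousOn (fun s => geodesicVel z w s / (a * geodesicFun z w s + b) ^ 2)
      (Set.Icc 0 1) :=
    (continuousOn_geodesicVel z w).div
      (((continuousOn_const.mul (continuousOn_geodesicFun z w)).add continuousOn_const).pow 2)
      fun s hs => pow_ne_zero 2 (hden s hs)
  have key := integral_chord_pow n hM hc
  simp only [geodesicFun_zero, geodesicFun_one, sub_self, zero_div, sub_zero] at key
  set m : ℂ := (w - z) / ((a * w + b) * (a * z + b)) with hm
  have hm0 : m ≠ 0 := div_ne_zero hd (mul_ne_zero hw hz)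
  -- Invariance of the bracket: the n-th power of the kernel produces m⁻ⁿ, which reduces the
  -- m^(2n+1) of `key` to m^(n+1).
  have e : ∀ s ∈ Set.uIcc (0 : ℝ) 1,
      (1 / (a * geodesicFun z w s + b) ^ 2) ^ (n + 1) * geodesicKernel z w n s =
      (m ^ n)⁻¹ * (((m - (geodesicFun z w s - z) / ((a * geodesicFun z w s + b) * (a * z + b))) *
        ((geodesicFun z w s - z) / ((a * geodesicFun z w s + b) * (a * z + b)))) ^ n *
          (geodesicVel z w s / (a * geodesicFun z w s + b) ^ 2)) := by
    intro s hs
    rw [Set.uIcc_of_le zero_le_one] at hs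
    have hs0 := hden s hs
    have e0 : m - (geodesicFun z w s - z) / ((a * geodesicFun z w s + b) * (a * z + b)) =
        (w - geodesicFun z w s) / ((a * w + b) * (a * geodesicFun z w s + b)) := by
      rw [hm, div_sub_div _ _ (mul_ne_zero hw hz) (mul_ne_zero hs0 hz), div_eq_div_iff
        (mul_ne_zero (mul_ne_zero hw hz) (mul_ne_zero hs0 hz)) (mul_ne_zero hw hs0)]
      ring
    have e1 : (w - geodesicFun z w s) / ((a * w + b) * (a * geodesicFun z w s + b)) *
        ((geodesicFun z w s - z) / ((a * geodesicFun z w s + b) * (a * z + b))) =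
        m * (1 / (a * geodesicFun z w s + b) ^ 2 *
          ((w - geodesicFun z w s) * (geodesicFun z w s - z) / (w - z))) := by
      rw [hm]
      generalize a * geodesicFun z w s + b = d at hs0
      generalize a * (z : ℂ) + b = d₁ at hz
      generalize a * (w : ℂ) + b = d₂ at hw
      field_simp
    rw [e0, e1, mul_pow m, mul_pow (1 / _), geodesicKernel,
      div_eq_mul_one_div (geodesicVel z w s)]
    generalize 1 / (a * geodesicFun z w s + b) ^ 2 = d
    field_simp
    ring
  rw [intervalIntegral.integral_congr e, intervalIntegral.integral_const_mul, key]
  field_simp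
  ring

end Geodesic

/-! ### Applying the operator term by term -/

lemma I_eq_integral {n : ℕ} (ψ : holomorphicDifferentials Γ (n + 1)) (z w : 𝔻) :
    I ψ z w = 1 / Complex.betaIntegral (n + 1 : ℕ) (n + 1 : ℕ) *
      ∫ s in (0 : ℝ)..1, extend ψ.1 (geodesicFun z w s) * geodesicKernel z w n s := by
  rw [I, if_neg n.succ_ne_zero, curveIntegral_eq_intervalIntegral_deriv, Nat.add_sub_cancel]
  congr 1
  -- The extended path is constant outside [0,1], so its derivative is identified only in the open
  -- interval; the end points are a null set.
  refine intervalIntegral.integral_congr_ae_restrict ?_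
  rw [Set.uIoc_of_le zero_le_one, ← restrict_Ioo_eq_restrict_Ioc]
  filter_upwards [ae_restrict_mem measurableSet_Ioo] with s hs
  rw [extend_geodesic z w (Set.Ioo_subset_Icc_self hs), deriv_extend_geodesic z w hs,
    _root_.smul_apply, ContinuousLinearMap.id_apply, smul_eq_mul, bracket,
    geodesicKernel, div_eq_mul_inv, ← inv_pow, inv_div, mul_assoc]

/-- The operator `I` may be applied to the Poincaré series term by term. -/
lemma IsCompactSurfaceGroup.hasSum_I (hΓ : IsCompactSurfaceGroup Γ) (hN : 2 ≤ N)
    (hP : poincareSeries Γ N ∈ holomorphicDifferentials Γ N) (z w : 𝔻) :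
    HasSum (fun γ : Γ => ((γ : Equiv.Perm 𝔻) w - (γ : Equiv.Perm 𝔻) z : ℂ) ^ N)
      (I ⟨poincareSeries Γ N, hP⟩ z w) := by
  obtain ⟨a, b, hab, hb, hs, hc, hd⟩ := hΓ.exists_den
  have := hΓ.countable
  obtain ⟨n, rfl⟩ : ∃ n, N = n + 1 := ⟨N - 1, by omega⟩
  -- The segment is compact in the disc, so one R < 1 gives a dominating series constant in s.
  obtain ⟨R, hR1, hR⟩ := exists_norm_geodesicFun_le z w
  obtain ⟨C, hC⟩ := isCompact_Icc.exists_bound_of_continuousOn (continuousOn_geodesicKernel z w n)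
  have hIcc : ∀ {s : ℝ}, s ∈ Set.uIoc (0 : ℝ) 1 → s ∈ Set.Icc (0 : ℝ) 1 := fun hs => by
    rw [Set.uIoc_of_le zero_le_one] at hs
    exact Set.Ioc_subset_Icc_self hs
  have hbd : ∀ γ, ∀ s ∈ Set.Icc (0 : ℝ) 1, ‖(1 / (a γ * geodesicFun z w s + b γ) ^ 2) ^ (n + 1)‖ ≤
      (((1 - R) ^ (n + 1))⁻¹) ^ 2 * ((‖b γ‖ ^ 2)⁻¹) ^ 2 := fun γ s hs =>
    norm_one_div_den_pow_le (hab γ) (hb γ) hR1 (hR s hs) hN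
  have hsum : HasSum
      (fun γ : Γ => ∫ s in (0 : ℝ)..1,
        (1 / (a γ * geodesicFun z w s + b γ) ^ 2) ^ (n + 1) * geodesicKernel z w n s)
      (∫ s in (0 : ℝ)..1, extend (poincareSeries Γ (n + 1)) (geodesicFun z w s) *
        geodesicKernel z w n s) := by
    have hbs : Summable fun γ : Γ =>
        (((1 - R) ^ (n + 1))⁻¹) ^ 2 * ((‖b γ‖ ^ 2)⁻¹) ^ 2 * C := (hs.mul_left _).mul_right _
    refine intervalIntegral.hasSum_integral_of_dominated_convergence
      (fun γ _ => (((1 - R) ^ (n + 1))⁻¹) ^ 2 * ((‖b γ‖ ^ 2)⁻¹) ^ 2 * C) (fun γ => ?_)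
      (fun γ => .of_forall fun s hs => ?_) (.of_forall fun _ _ => hbs)
      intervalIntegrable_const (.of_forall fun s hs' => ?_)
    · have hcont : ContinuousOn (fun s : ℝ =>
          (1 / (a γ * geodesicFun z w s + b γ) ^ 2) ^ (n + 1) * geodesicKernel z w n s)
          (Set.Icc 0 1) :=
        ((continuousOn_const.div (((continuousOn_const.mul (continuousOn_geodesicFun z w)).add
          continuousOn_const).pow 2) fun s hs => pow_ne_zero 2 (den_ne_zero_of_norm_le (hab γ)
            (hb γ) (norm_geodesicFun_lt_one z w hs))).pow _).mul
          (continuousOn_geodesicKernel z w n)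
      exact (hcont.mono fun _ => hIcc).aestronglyMeasurable measurableSet_uIoc
    · rw [norm_mul]
      exact mul_le_mul (hbd γ s (hIcc hs)) (hC s (hIcc hs)) (norm_nonneg _) (by positivity)
    · have hlt := norm_geodesicFun_lt_one z w (hIcc hs')
      refine HasSum.mul_right _ ?_
      rw [extend_of_norm_lt _ hlt]
      simp only [poincareSeries, pullback, one_mul, hd, Complex.UnitDisc.coe_mk]
      exact (Summable.of_norm_bounded (hs.mul_left _) fun γ => hbd γ s (hIcc hs')).hasSum
  have hB := betaIntegral_nat_ne_zero n.succ_ne_zero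
  rw [I_eq_integral]
  refine (hsum.mul_left (1 / Complex.betaIntegral (n + 1 : ℕ) (n + 1 : ℕ))).congr_fun ?_
  intro γ
  rw [integral_den_mul_geodesicKernel z w (hab γ) (hb γ), ← mul_assoc, one_div_mul_cancel hB,
    one_mul, hc]

end DiscQuotient

theorem corollary4 (Γ : Subgroup (Equiv.Perm 𝔻)) (hΓ : DiscQuotient.IsCompactSurfaceGroup Γ)
    (N : ℕ) (hN : 2 ≤ N) :
    -- the Poincaré series converges locally uniformly on the disc
    HasSumLocallyUniformly
      (fun (γ : Γ) (τ : 𝔻) => DiscQuotient.pullback N (γ : Equiv.Perm 𝔻) (fun _ => 1) τ)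
      (DiscQuotient.poincareSeries Γ N) ∧
    -- it is a holomorphic differential on the surface, and its image under `I` is the series
    ∃ hP : DiscQuotient.poincareSeries Γ N ∈ DiscQuotient.holomorphicDifferentials Γ N,
      (∀ z w : 𝔻,
        HasSum (fun γ : Γ => (((γ : Equiv.Perm 𝔻) w : ℂ) - ((γ : Equiv.Perm 𝔻) z : ℂ)) ^ N)
          (DiscQuotient.I ⟨DiscQuotient.poincareSeries Γ N, hP⟩ z w)) ∧
      (∀ z w : 𝔻,
        Summable (fun γ : Γ => (((γ : Equiv.Perm 𝔻) z : ℂ) - ((γ : Equiv.Perm 𝔻) w : ℂ)) ^ N) ∧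
        DiscQuotient.I ⟨DiscQuotient.poincareSeries Γ N, hP⟩ z w =
          (-1) ^ N * ∑' γ : Γ, (((γ : Equiv.Perm 𝔻) z : ℂ) - ((γ : Equiv.Perm 𝔻) w : ℂ)) ^ N) ∧
      -- this function of `(z, w)` is holomorphic and invariant under the diagonal action
      DiscQuotient.Holomorphic₂ (DiscQuotient.I ⟨DiscQuotient.poincareSeries Γ N, hP⟩) ∧
      (∀ γ ∈ Γ, ∀ z w : 𝔻,
        DiscQuotient.I ⟨DiscQuotient.poincareSeries Γ N, hP⟩ (γ z) (γ w) =
          DiscQuotient.I ⟨DiscQuotient.poincareSeries Γ N, hP⟩ z w) := by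
  have key := fun z w => hΓ.hasSum_I hN (hΓ.poincareSeries_mem hN) z w
  -- Holomorphy and invariance are read off from the chord series rather than from the integral.
  have hI : DiscQuotient.I ⟨DiscQuotient.poincareSeries Γ N, hΓ.poincareSeries_mem hN⟩ =
      fun z w => ∑' γ : Γ, ((γ : Equiv.Perm 𝔻) w - (γ : Equiv.Perm 𝔻) z : ℂ) ^ N := by
    funext z w
    exact (key z w).tsum_eq.symm
  refine ⟨hΓ.hasSumLocallyUniformly hN, hΓ.poincareSeries_mem hN, key, fun z w =>
    ⟨hΓ.summable_chord_pow hN w z, ?_⟩, ?_, fun γ hγ z w => ?_⟩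
  · rw [hI, ← tsum_mul_left]
    refine tsum_congr fun γ => ?_
    rw [← mul_pow, neg_one_mul, neg_sub]
  · rw [hI]
    exact hΓ.holomorphic₂_tsum hN
  · rw [hI]
    exact DiscQuotient.tsum_chord_pow_invariant N hγ z w
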